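/- Let $\lambda_A,\lambda_B\ge 0$ and $p\in[0,1]$. Let the service times at nodes $A$ and $B$ be exponentially distributed with means $\alpha_A$ and $\alpha_B$ and distribution functions $G_A$ and $G_B$, and let $m_A,m_B$ be real-valued functions. For $t\ge 0$ consider the equilibrium equation of the two-node pensions fund with Poisson arrivals (rates $\lambda_A$ and $\lambda_B$ from outside at $A$ and $B$, transition probability $p$ from $A$ to $B$), $$m_A(t)\lambda_A\int_0^t(1-G_A(v))\,dv=m_B(t)\int_0^t\bigl(p\lambda_AG_A(v)+\lambda_B\bigr)\bigl(1-G_B(t-v)\bigr)\,dv.\qquad(2)$$ Then, for every $t\ge 0$, the left-hand side of (2) equals $m_A(t)\lambda_A\alpha_A\bigl(1-e^{-t/\alpha_A}\bigr)$, and the right-hand side of (2) equals (i) $m_B(t)(p\lambda_A+\lambda_B)\alpha_B\bigl(1-e^{-t/\alpha_B}\bigr)-m_B(t)\dfrac{p\lambda_A\alpha_A\alpha_B}{\alpha_A-\alpha_B}\bigl(e^{-t/\alpha_A}-e^{-t/\alpha_B}\bigr)$ if $\alpha_A\ne\alpha_B$; (ii) $m_B(t)(p\lambda_A+\lambda_B)\alpha_A\bigl(1-e^{-t/\alpha_A}\bigr)-m_B(t)\,p\lambda_A\,t\,e^{-t/\alpha_A}$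 if $\alpha_A=\alpha_B$. Consequently, (2) holds at $t$ if and only if, respectively, (i) $m_A(t)\lambda_A\alpha_A\bigl(1-e^{-t/\alpha_A}\bigr)=m_B(t)(p\lambda_A+\lambda_B)\alpha_B\bigl(1-e^{-t/\alpha_B}\bigr)-m_B(t)\dfrac{p\lambda_A\alpha_A\alpha_B}{\alpha_A-\alpha_B}\bigl(e^{-t/\alpha_A}-e^{-t/\alpha_B}\bigr)$ if $\alpha_A\ne\alpha_B$; (ii) $m_A(t)\lambda_A\alpha_A\bigl(1-e^{-t/\alpha_A}\bigr)=m_B(t)(p\lambda_A+\lambda_B)\alpha_A\bigl(1-e^{-t/\alpha_A}\bigr)-m_B(t)\,p\lambda_A\,t\,e^{-t/\alpha_A}$ if $\alpha_A=\alpha_B$. -/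

import Mathlib

open MeasureTheory ProbabilityTheory

noncomputable section

namespace PensionFund

/-- The law `ν` of a service time is an exponential distribution (of some rate `r > 0`). -/
def IsExponentialLaw (ν : Measure ℝ) : Prop :=
  ∃ r : ℝ, 0 < r ∧ ν = expMeasure r

/-- The mean service time `α` of a service time law `ν`. -/
def meanService (ν : Measure ℝ) : ℝ := ∫ x, x ∂ν

/-- Left-hand side of the equilibrium equation at time `t`:
`m_A(t) λ_A ∫₀ᵗ (1 - G_A(v)) dv`, where `G_A` is the distribution function of the service time
law `νA` at node A. -/
def contributionSide (lamA : ℝ) (νA : Measure ℝ) (mA : ℝ → ℝ) (t : ℝ) : ℝ :=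
  mA t * lamA * ∫ v in (0 : ℝ)..t, (1 - cdf νA v)

/-- Right-hand side of the equilibrium equation at time `t`:
`m_B(t) ∫₀ᵗ (p λ_A G_A(v) + λ_B) (1 - G_B(t - v)) dv`, where `G_A`, `G_B` are the distribution
functions of the service time laws `νA`, `νB` at the nodes A and B. -/
def pensionSide (lamA lamB p : ℝ) (νA νB : Measure ℝ) (mB : ℝ → ℝ) (t : ℝ) : ℝ :=
  mB t * ∫ v in (0 : ℝ)..t, (p * lamA * cdf νA v + lamB) * (1 - cdf νB (t - v))

/-- The equilibrium equation of the two-node fund with Poisson arrivals, at time `t`. -/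
def EquilibriumEq (lamA lamB p : ℝ) (νA νB : Measure ℝ) (mA mB : ℝ → ℝ) (t : ℝ) : Prop :=
  contributionSide lamA νA mA t = pensionSide lamA lamB p νA νB mB t

end PensionFund

end

namespace PensionFund

/-! With rates r = 1/αA and s = 1/αB, `1 - cdf` is a pure exponential on [0, t], so the pension
integrand combines e^(-s(t-v)) and e^(-rv-s(t-v)) = e^(-st) e^((s-r)v). Only the integral of the
last factor separates the cases: (e^((s-r)t) - 1)/(s-r) if r ≠ s, and t if r = s.
`integral_cdf_mul_one_sub_cdf_expMeasure` isolates it; both equivalences then follow by substituting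
the two sides. -/

/-- The exponential law of rate `r` has mean `r⁻¹`. -/
lemma integral_id_expMeasure {r : ℝ} (hr : 0 < r) : ∫ x, x ∂(expMeasure r) = r⁻¹ := by
  have hmeas : Measurable (gammaPDF 1 r) := (measurable_gammaPDFReal 1 r).ennreal_ofReal
  rw [expMeasure, gammaMeasure, integral_withDensity_eq_integral_toReal_smul hmeas
    (Filter.Eventually.of_forall fun _ => ENNReal.ofReal_lt_top)]
  -- The density is nonzero at 0, but the factor x vanishes there, so the open half-line suffices.
  -- The exponent is written 2 - 1 to match the integral defining Γ(2) = 1.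
  have hind : (fun x => (gammaPDF 1 r x).toReal • x)
      = Set.indicator (Set.Ioi 0) fun x => r * (x ^ ((2 : ℝ) - 1) * Real.exp (-(r * x))) := by
    funext x
    rw [gammaPDF, ENNReal.toReal_ofReal (gammaPDFReal_nonneg zero_lt_one hr x), gammaPDFReal,
      smul_eq_mul]
    rcases lt_trichotomy x 0 with hx | hx | hx
    · simp [hx.le, hx.not_ge]
    · simp [hx]
    · rw [Set.indicator_of_mem (Set.mem_Ioi.2 hx), if_pos hx.le]
      norm_num
      ring
  rw [hind, integral_indicator measurableSet_Ioi, integral_const_mul,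
    Real.integral_rpow_mul_exp_neg_mul_Ioi two_pos hr, Real.Gamma_two, Real.rpow_two]
  field_simp

lemma cdf_expMeasure_of_nonneg {r x : ℝ} (hr : 0 < r) (hx : 0 ≤ x) :
    cdf (expMeasure r) x = 1 - Real.exp (-(r * x)) := by
  rw [cdf_expMeasure_eq hr, if_pos hx]

lemma intervalIntegral_exp_mul {k : ℝ} (hk : k ≠ 0) (t : ℝ) :
    ∫ v in (0 : ℝ)..t, Real.exp (k * v) = (Real.exp (k * t) - 1) / k := by
  rw [intervalIntegral.integral_comp_mul_left (fun x => Real.exp x) hk, integral_exp]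
  simp [div_eq_inv_mul]

lemma integral_one_sub_cdf_expMeasure {r t : ℝ} (hr : 0 < r) (ht : 0 ≤ t) :
    ∫ v in (0 : ℝ)..t, (1 - cdf (expMeasure r) v) = (1 - Real.exp (-(r * t))) / r := by
  have hcongr : ∫ v in (0 : ℝ)..t, (1 - cdf (expMeasure r) v)
      = ∫ v in (0 : ℝ)..t, Real.exp (-r * v) := by
    refine intervalIntegral.integral_congr fun v hv => ?_
    rw [Set.uIcc_of_le ht] at hv
    simp [cdf_expMeasure_of_nonneg hr hv.1]
  rw [hcongr, intervalIntegral_exp_mul (neg_ne_zero.2 hr.ne'), neg_mul]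
  field_simp
  ring

/-- The convolution integral of the pension side, up to the integral of a single exponential. -/
lemma integral_cdf_mul_one_sub_cdf_expMeasure {r s t : ℝ} (hr : 0 < r) (hs : 0 < s) (ht : 0 ≤ t)
    (a b : ℝ) :
    ∫ v in (0 : ℝ)..t, (a * cdf (expMeasure r) v + b) * (1 - cdf (expMeasure s) (t - v))
      = (a + b) * ((1 - Real.exp (-(s * t))) / s)
        - a * (Real.exp (-(s * t)) * ∫ v in (0 : ℝ)..t, Real.exp ((s - r) * v)) := by
  have hcongr : ∫ v in (0 : ℝ)..t,
        (a * cdf (expMeasure r) v + b) * (1 - cdf (expMeasure s) (t - v))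
      = ∫ v in (0 : ℝ)..t, ((a + b) * Real.exp (-(s * t)) * Real.exp (s * v)
          - a * Real.exp (-(s * t)) * Real.exp ((s - r) * v)) := by
    refine intervalIntegral.integral_congr fun v hv => ?_
    rw [Set.uIcc_of_le ht] at hv
    have h₁ : Real.exp (-(s * (t - v))) = Real.exp (-(s * t)) * Real.exp (s * v) := by
      rw [← Real.exp_add]; ring_nf
    have h₂ : Real.exp ((s - r) * v) = Real.exp (s * v) * Real.exp (-(r * v)) := by
      rw [← Real.exp_add]; ring_nf
    simp only [cdf_expMeasure_of_nonneg hr hv.1, cdf_expMeasure_of_nonneg hs (sub_nonneg.2 hv.2),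
      h₁, h₂]
    ring
  have hint (c k : ℝ) : IntervalIntegrable (fun v => c * Real.exp (k * v)) volume 0 t :=
    (by fun_prop : Continuous fun v => c * Real.exp (k * v)).intervalIntegrable _ _
  rw [hcongr, intervalIntegral.integral_sub (hint _ _) (hint _ _),
    intervalIntegral.integral_const_mul, intervalIntegral.integral_const_mul,
    intervalIntegral_exp_mul hs.ne']
  have h : Real.exp (-(s * t)) * Real.exp (s * t) = 1 := by
    rw [← Real.exp_add]; simp
  linear_combination (a + b) / s * h

lemma contributionSide_expMeasure {r t : ℝ} (hr : 0 < r) (ht : 0 ≤ t) (lamA : ℝ) (mA : ℝ → ℝ) :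
    contributionSide lamA (expMeasure r) mA t
      = mA t * lamA * r⁻¹ * (1 - Real.exp (-t / r⁻¹)) := by
  rw [contributionSide, integral_one_sub_cdf_expMeasure hr ht, div_inv_eq_mul, neg_mul, mul_comm t]
  ring

lemma pensionSide_expMeasure_of_ne {r s t : ℝ} (hr : 0 < r) (hs : 0 < s) (hrs : r ≠ s)
    (ht : 0 ≤ t) (lamA lamB p : ℝ) (mB : ℝ → ℝ) :
    pensionSide lamA lamB p (expMeasure r) (expMeasure s) mB t
      = mB t * (p * lamA + lamB) * s⁻¹ * (1 - Real.exp (-t / s⁻¹))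
        - mB t * (p * lamA * r⁻¹ * s⁻¹ / (r⁻¹ - s⁻¹))
          * (Real.exp (-t / r⁻¹) - Real.exp (-t / s⁻¹)) := by
  have hsr : s - r ≠ 0 := sub_ne_zero.2 hrs.symm
  -- In terms of means, αA αB/(αA - αB) is exactly 1/(s - r).
  have hcoef : p * lamA * r⁻¹ * s⁻¹ / (r⁻¹ - s⁻¹) = p * lamA / (s - r) := by
    rw [inv_sub_inv hr.ne' hs.ne']
    field_simp
  have hexp : Real.exp (-(s * t)) * Real.exp ((s - r) * t) = Real.exp (-(r * t)) := by
    rw [← Real.exp_add]; ring_nf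
  rw [pensionSide, integral_cdf_mul_one_sub_cdf_expMeasure hr hs ht,
    intervalIntegral_exp_mul hsr, hcoef, div_inv_eq_mul, div_inv_eq_mul, neg_mul, neg_mul,
    mul_comm t, mul_comm t]
  linear_combination -(mB t * p * lamA / (s - r)) * hexp

lemma pensionSide_expMeasure_self {r t : ℝ} (hr : 0 < r) (ht : 0 ≤ t) (lamA lamB p : ℝ)
    (mB : ℝ → ℝ) :
    pensionSide lamA lamB p (expMeasure r) (expMeasure r) mB t
      = mB t * (p * lamA + lamB) * r⁻¹ * (1 - Real.exp (-t / r⁻¹))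
        - mB t * p * lamA * t * Real.exp (-t / r⁻¹) := by
  rw [pensionSide, integral_cdf_mul_one_sub_cdf_expMeasure hr hr ht, div_inv_eq_mul, neg_mul,
    mul_comm t r]
  -- Equal rates make the remaining exponential constantly 1; its integral is the factor t.
  simp only [sub_self, zero_mul, Real.exp_zero, intervalIntegral.integral_const, sub_zero,
    smul_eq_mul, mul_one]
  ring

end PensionFund

theorem mainTheorem4 (lamA lamB p : ℝ) (hlamA : 0 ≤ lamA) (hlamB : 0 ≤ lamB)
    (hp0 : 0 ≤ p) (hp1 : p ≤ 1)
    (νA νB : MeasureTheory.Measure ℝ)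
    (hA : PensionFund.IsExponentialLaw νA) (hB : PensionFund.IsExponentialLaw νB)
    (αA αB : ℝ) (hαA : αA = PensionFund.meanService νA) (hαB : αB = PensionFund.meanService νB)
    (mA mB : ℝ → ℝ) (t : ℝ) (ht : 0 ≤ t) :
    PensionFund.contributionSide lamA νA mA t
        = mA t * lamA * αA * (1 - Real.exp (-t / αA)) ∧
    (αA ≠ αB →
      PensionFund.pensionSide lamA lamB p νA νB mB t
          = mB t * (p * lamA + lamB) * αB * (1 - Real.exp (-t / αB))
            - mB t * (p * lamA * αA * αB / (αA - αB))
              * (Real.exp (-t / αA) - Real.exp (-t / αB)) ∧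
      (PensionFund.EquilibriumEq lamA lamB p νA νB mA mB t ↔
        mA t * lamA * αA * (1 - Real.exp (-t / αA))
          = mB t * (p * lamA + lamB) * αB * (1 - Real.exp (-t / αB))
            - mB t * (p * lamA * αA * αB / (αA - αB))
              * (Real.exp (-t / αA) - Real.exp (-t / αB)))) ∧
    (αA = αB →
      PensionFund.pensionSide lamA lamB p νA νB mB t
          = mB t * (p * lamA + lamB) * αA * (1 - Real.exp (-t / αA))
            - mB t * p * lamA * t * Real.exp (-t / αA) ∧
      (PensionFund.EquilibriumEq lamA lamB p νA νB mA mB t ↔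
        mA t * lamA * αA * (1 - Real.exp (-t / αA))
          = mB t * (p * lamA + lamB) * αA * (1 - Real.exp (-t / αA))
            - mB t * p * lamA * t * Real.exp (-t / αA))) := by
  obtain ⟨r, hr, rfl⟩ := hA
  obtain ⟨s, hs, rfl⟩ := hB
  rw [PensionFund.meanService, PensionFund.integral_id_expMeasure hr] at hαA
  rw [PensionFund.meanService, PensionFund.integral_id_expMeasure hs] at hαB
  subst hαA hαB
  have hC := PensionFund.contributionSide_expMeasure hr ht lamA mA
  refine ⟨hC, fun hne => ?_, fun heq => ?_⟩
  · have hP := PensionFund.pensionSide_expMeasure_of_ne hr hs (fun h => hne (by rw [h])) ht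
      lamA lamB p mB
    exact ⟨hP, by rw [PensionFund.EquilibriumEq, hC, hP]⟩
  · obtain rfl := inv_injective heq
    have hP := PensionFund.pensionSide_expMeasure_self hr ht lamA lamB p mB
    exact ⟨hP, by rw [PensionFund.EquilibriumEq, hC, hP]⟩
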